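/- Let $M$ be a smooth manifold of dimension $2n$, let $Z\subset M$ be a hypersurface possessing a defining function $t_0$ (a smooth function $t_0:M\to\mathbb{R}$ with $Z=t_0^{-1}(0)$ and $dt_0\neq 0$ at every point of $Z$), and let ${}^bTM$ be the $b$-tangent bundle of $(M,Z)$, whose sections are the vector fields tangent to $Z$. Let $\omega$ be a $b$-symplectic form on $(M,Z)$, that is, a closed $b$-form $\omega=\alpha\wedge\frac{dt_0}{t_0}+\beta$ (with $\alpha$ a smooth 1-form and $\beta$ a smooth 2-form on $M$) which is nondegenerate on ${}^bT_pM$ for all $p\in M$. A $b$-function is a function $f=c\log|t_0|+g:M\to\mathbb{R}\cup\{\infty\}$ with $c\in\mathbb{R}$ and $g$ smooth (it is smooth if $c=0$, and infinite exactly on $Z$ if $c\ne 0$); its differential is the $b$-form $df=c\frac{dt_0}{t_0}+dg$, its Hamiltonian vector field $X_f$ is defined by $\iota_{X_f}\omega=-df$, and $\{f,g\}=\omega(X_f,X_g)$. A non-commutative $b$-integrable system of rank $r$ is an $s$-tuple $F=(f_1,\dots,f_s)$, $r\le s$, with $f_1,\dots,f_r$ $b$-functions and $f_{r+1},\dots,f_s$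 smooth functions, such that: (1) $df_1,\dots,df_s$ are linearly independent as $b$-cotangent vectors on a dense open subset of $M$ and on a dense open subset of $Z$; (2) $\{f_i,f_j\}=0$ for all $i\le r$, $j\le s$; (3) $r+s=2n$; (4) $X_{f_1},\dots,X_{f_r}$ are linearly independent as ordinary tangent vectors at some point of $Z$. Put $V_F=F(M)\cap\mathbb{R}^s$, with the bracket determined by $\{g,h\}_{V_F}\circ F=\{g\circ F,h\circ F\}$ for smooth functions $g,h$ on $V_F$. (If $\{g\circ F,h\circ F\}$ is not constant on the fibres of $F$, then $\{g,h\}_{V_F}$ is read as the relation consisting of all pairs $\big(F(p),\{g\circ F,h\circ F\}(p)\big)$ with $F(p)\in\mathbb{R}^s$.) Two systems $F,F'$ are equivalent if there is a smooth map $\mu:V_F\to V_{F'}$ that is Poisson, i.e. $\{g\circ\mu,h\circ\mu\}_{V_F}=\{g,h\}_{V_{F'}}\circ\mu$ for all smooth $g,h$ on $V_{F'}$ (for relations: $(y,b)\in\{g\circ\mu,h\circ\mu\}_{V_F}$ implies $(\mu(y),b)\in\{g,h\}_{V_{F'}}$), with $F'=\mu\circ F$ wherever $F$ is finite. Then, for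 every non-commutative $b$-integrable system $F=(f_1,\dots,f_s)$ of rank $r$ on $(M,\omega)$: (a) at least one of the commuting integrals $f_1,\dots,f_r$ is not smooth, i.e. has a logarithmic part $c\log|t_0|$ with $c\neq0$; (b) there exist a defining function $t$ of $Z$ and a non-commutative $b$-integrable system $F'=(\log|t|,f_2',\dots,f_s')$ of rank $r$ on $(M,\omega)$, with $f_2',\dots,f_s'$ smooth, that is equivalent to $F$. -/

import Mathlib

open Set
open scoped Manifold ContDiff Bundle

noncomputable section

namespace BSymplectic

/-- The differential at `p` of a real function on a manifold, as a linear form on the tangent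
space. -/
def diffAt {m : ℕ} {M : Type*} [TopologicalSpace M] [ChartedSpace (EuclideanSpace ℝ (Fin m)) M]
    (u : M → ℝ) (p : M) : TangentSpace (𝓡 m) p →L[ℝ] ℝ :=
  mfderiv (𝓡 m) 𝓘(ℝ, ℝ) u p

/-- `t` is a defining function of `Z`: a smooth function on `M` with zero set `Z` whose differential
does not vanish at any point of `Z`. -/
def IsDefiningFunction {m : ℕ} {M : Type*} [TopologicalSpace M]
    [ChartedSpace (EuclideanSpace ℝ (Fin m)) M]
    (Z : Set M) (t : C^∞⟮𝓡 m, M; ℝ⟯) : Prop :=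
  (∀ p, p ∈ Z ↔ t p = 0) ∧ ∀ p ∈ Z, diffAt (m := m) t p ≠ 0

/-- A hypersurface `Z` of the `m`-dimensional manifold `M`, with a chosen defining function `t`.
The notions below are expressed with the help of `t`; another defining function is `u * t` with
`u` smooth and nowhere zero, and gives isomorphic objects. -/
structure BManifold (m : ℕ) (M : Type*) [TopologicalSpace M]
    [ChartedSpace (EuclideanSpace ℝ (Fin m)) M] where
  Z : Set M
  t : C^∞⟮𝓡 m, M; ℝ⟯
  isDefiningFunction : IsDefiningFunction Z t

section BTangent

variable {m : ℕ} {M : Type*} [TopologicalSpace M] [ChartedSpace (EuclideanSpace ℝ (Fin m)) M]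

/-- The fibre at `p` of the `b`-tangent bundle: the pairs `(v, a)` with `v` tangent to `M` at `p`
and `dt(v) = a t(p)`.  A vector field `X` tangent to `Z` satisfies `X(t) = a t` for a unique smooth
function `a` (the pairing of `X` with `dt/t`), and the value of `X` at `p` as a section of the
`b`-tangent bundle is `(X p, a p)`.  Off `Z` the fibre is the tangent space (`a = dt(v)/t(p)` is
determined by `v`), while on `Z` it consists of all pairs of a vector `v` tangent to `Z` and a
number `a`, the pair `(0, 1)` being the value of `t ∂/∂t`. -/
def BTangent (B : BManifold m M) (p : M) : Submodule ℝ (TangentSpace (𝓡 m) p × ℝ) where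
  carrier := {x | diffAt B.t p x.1 = x.2 * B.t p}
  add_mem' := by
    intro x y hx hy
    simp only [mem_ofPred_eq, Prod.fst_add, Prod.snd_add, map_add] at hx hy ⊢
    rw [hx, hy, add_mul]
  zero_mem' := by
    simp only [mem_ofPred_eq, Prod.fst_zero, Prod.snd_zero, map_zero, zero_mul]
  smul_mem' := by
    intro c x hx
    simp only [mem_ofPred_eq, Prod.smul_fst, Prod.smul_snd, map_smul, smul_eq_mul] at hx ⊢
    rw [hx, mul_assoc]

/-- The natural map from the `b`-tangent space to the tangent space. -/
def anchor (B : BManifold m M) (p : M) : BTangent B p →ₗ[ℝ] TangentSpace (𝓡 m) p :=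
  (LinearMap.fst ℝ (TangentSpace (𝓡 m) p) ℝ).comp (BTangent B p).subtype

/-- The `b`-covector `dt/t` at `p`. -/
def dlog (B : BManifold m M) (p : M) : Module.Dual ℝ (BTangent B p) :=
  (LinearMap.snd ℝ (TangentSpace (𝓡 m) p) ℝ).comp (BTangent B p).subtype

/-- The differential at `p` of a real function, smooth near `p`, as a `b`-covector. -/
def dAt (B : BManifold m M) (u : M → ℝ) (p : M) : Module.Dual ℝ (BTangent B p) :=
  (diffAt u p).toLinearMap.comp (anchor B p)

instance (p : M) : FiniteDimensional ℝ (TangentSpace (𝓡 m) p) :=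
  inferInstanceAs (FiniteDimensional ℝ (EuclideanSpace ℝ (Fin m)))

/-! ### `b`-functions -/

/-- A `b`-function `c log|t| + g`, with `c` real and `g` smooth. -/
structure BFunction (B : BManifold m M) where
  /-- the coefficient `c` of the logarithm -/
  coeff : ℝ
  /-- the smooth function `g` -/
  smoothPart : C^∞⟮𝓡 m, M; ℝ⟯

/-- The finite value of a `b`-function (meaningful off `Z`, or if `c = 0`). -/
def BFunction.realValue {B : BManifold m M} (f : BFunction B) (p : M) : ℝ :=
  f.coeff * Real.log |B.t p| + f.smoothPart p

open Classical in
/-- A `b`-function as a function with values in `ℝ ∪ {∞}`: it is infinite exactly at the points of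
`Z`, if `c ≠ 0`, and nowhere, if `c = 0`. -/
def BFunction.value {B : BManifold m M} (f : BFunction B) (p : M) : OnePoint ℝ :=
  if f.coeff ≠ 0 ∧ p ∈ B.Z then OnePoint.infty else ((f.realValue p : ℝ) : OnePoint ℝ)

/-- The `b`-function is a smooth function (has no logarithmic part). -/
def BFunction.IsSmooth {B : BManifold m M} (f : BFunction B) : Prop := f.coeff = 0

/-- The differential `c dt/t + dg` of a `b`-function, at the point `p`. -/
def BFunction.d {B : BManifold m M} (f : BFunction B) (p : M) : Module.Dual ℝ (BTangent B p) :=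
  f.coeff • dlog B p + dAt B f.smoothPart p

open Classical in
/-- The function `log|t|` with values in `ℝ ∪ {∞}`, infinite on the zero set of `t`. -/
def logAbs (t : C^∞⟮𝓡 m, M; ℝ⟯) (p : M) : OnePoint ℝ :=
  if t p = 0 then OnePoint.infty else ((Real.log |t p| : ℝ) : OnePoint ℝ)

end BTangent

/-! ### `b`-symplectic forms -/

section BForm

variable {m : ℕ} {M : Type*} [TopologicalSpace M] [ChartedSpace (EuclideanSpace ℝ (Fin m)) M]
  [IsManifold (𝓡 m) ∞ M]

/-- A `b`-form of degree two, `α ∧ dt/t + β`, with `α` a smooth one-form and `β` a smooth two-form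
on `M`. -/
structure BTwoForm (B : BManifold m M) where
  α (p : M) : TangentSpace (𝓡 m) p →L[ℝ] ℝ
  β (p : M) : TangentSpace (𝓡 m) p →L[ℝ] TangentSpace (𝓡 m) p →L[ℝ] ℝ
  β_alt (p : M) (v : TangentSpace (𝓡 m) p) : β p v v = 0
  α_smooth : ContMDiff (𝓡 m) ((𝓡 m).prod 𝓘(ℝ, EuclideanSpace ℝ (Fin m) →L[ℝ] ℝ)) ∞
    (fun p ↦ Bundle.TotalSpace.mk' (EuclideanSpace ℝ (Fin m) →L[ℝ] ℝ)
      (E := fun p : M ↦ (TangentSpace (𝓡 m) p →L[ℝ] ℝ)) p (α p))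
  β_smooth : ContMDiff (𝓡 m)
    ((𝓡 m).prod 𝓘(ℝ, EuclideanSpace ℝ (Fin m) →L[ℝ] EuclideanSpace ℝ (Fin m) →L[ℝ] ℝ)) ∞
    (fun p ↦ Bundle.TotalSpace.mk'
      (EuclideanSpace ℝ (Fin m) →L[ℝ] EuclideanSpace ℝ (Fin m) →L[ℝ] ℝ)
      (E := fun p : M ↦ (TangentSpace (𝓡 m) p →L[ℝ] TangentSpace (𝓡 m) p →L[ℝ] ℝ)) p (β p))

variable {B : BManifold m M}

/-- The alternating bilinear form defined by `α ∧ dt/t + β` on the `b`-tangent space at `p`. -/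
def BTwoForm.at (Ω : BTwoForm B) (p : M) : LinearMap.BilinForm ℝ (BTangent B p) :=
  LinearMap.mk₂ ℝ
    (fun x y ↦ Ω.α p (anchor B p x) * dlog B p y - Ω.α p (anchor B p y) * dlog B p x
      + Ω.β p (anchor B p x) (anchor B p y))
    (by intro x x' y; simp only [map_add, add_apply]; ring)
    (by intro c x y; simp only [map_smul, smul_apply, smul_eq_mul]; ring)
    (by intro x y y'; simp only [map_add]; ring)
    (by intro c x y; simp only [map_smul, smul_eq_mul]; ring)

/-- The value of `α ∧ dt/t + β` on two vector fields, a function on `M \ Z`. -/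
def BTwoForm.eval (Ω : BTwoForm B) (X Y : Π p : M, TangentSpace (𝓡 m) p) (p : M) : ℝ :=
  (Ω.α p (X p) * diffAt B.t p (Y p) - Ω.α p (Y p) * diffAt B.t p (X p)) / B.t p
    + Ω.β p (X p) (Y p)

/-- A vector field on `M` is smooth. -/
def IsSmoothField (X : Π p : M, TangentSpace (𝓡 m) p) : Prop :=
  ContMDiff (𝓡 m) ((𝓡 m).prod 𝓘(ℝ, EuclideanSpace ℝ (Fin m))) ∞
    (fun p ↦ (⟨p, X p⟩ : TangentBundle (𝓡 m) M))

/-- The `b`-form is closed.  Its differential is the continuous extension to the `b`-tangent bundle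
of the exterior differential on the dense set `M \ Z`, which is given there by
`dΩ(X,Y,W) = X Ω(Y,W) - Y Ω(X,W) + W Ω(X,Y) - Ω([X,Y],W) + Ω([X,W],Y) - Ω([Y,W],X)`. -/
def BTwoForm.IsClosed (Ω : BTwoForm B) : Prop :=
  ∀ X Y W : Π p : M, TangentSpace (𝓡 m) p, IsSmoothField X → IsSmoothField Y → IsSmoothField W →
    ∀ p ∉ B.Z,
      diffAt (Ω.eval Y W) p (X p)
        - diffAt (Ω.eval X W) p (Y p)
        + diffAt (Ω.eval X Y) p (W p)
        - Ω.eval (VectorField.mlieBracket (𝓡 m) X Y) W p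
        + Ω.eval (VectorField.mlieBracket (𝓡 m) X W) Y p
        - Ω.eval (VectorField.mlieBracket (𝓡 m) Y W) X p = 0

/-- A `b`-symplectic form: a closed `b`-form of degree two which is of maximal rank, at every point,
on the `b`-tangent space. -/
structure BSymplecticForm (B : BManifold m M) extends BTwoForm B where
  closed : toBTwoForm.IsClosed
  nondegenerate (p : M) : (toBTwoForm.at p).Nondegenerate

/-- The `b`-tangent vector `X` with `ι_X Ω = -ξ`, for a `b`-covector `ξ` at `p`.  For `ξ = df` this
is the value at `p` of the Hamiltonian vector field of `f`. -/
def BSymplecticForm.ham (Ω : BSymplecticForm B) (p : M) (ξ : Module.Dual ℝ (BTangent B p)) :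
    BTangent B p :=
  ((Ω.toBTwoForm.at p).toDual (Ω.nondegenerate p)).symm (-ξ)

/-- The Poisson bracket `{f,g} = Ω(X_f,X_g)` at `p`, as a function of `df` and `dg`. -/
def BSymplecticForm.bracket (Ω : BSymplecticForm B) (p : M)
    (ξ η : Module.Dual ℝ (BTangent B p)) : ℝ :=
  Ω.toBTwoForm.at p (Ω.ham p ξ) (Ω.ham p η)

end BForm

/-! ### Non-commutative `b`-integrable systems -/

section Systems

variable {n : ℕ} {M : Type*} [TopologicalSpace M]
  [ChartedSpace (EuclideanSpace ℝ (Fin (2 * n))) M] [IsManifold (𝓡 (2 * n)) ∞ M]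
  {B : BManifold (2 * n) M}

/-- The `s`-tuple `F` is a non-commutative `b`-integrable system of rank `r` on a `2n`-dimensional
`b`-symplectic manifold.  The commuting part consists of the first `r` functions. -/
structure IsNCBIntegrable (Ω : BSymplecticForm B) (r s : ℕ) (F : Fin s → BFunction B) : Prop where
  r_le_s : r ≤ s
  /-- The functions outside the commuting part are smooth. -/
  smooth_of_le : ∀ i : Fin s, r ≤ i.val → (F i).IsSmooth
  /-- The differentials are independent `b`-covectors on a dense open subset of `M`. -/
  independent : ∃ U : Set M, IsOpen U ∧ Dense U ∧
    ∀ p ∈ U, LinearIndependent ℝ (fun i ↦ (F i).d p)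
  /-- The differentials are independent `b`-covectors on a dense open subset `U ∩ Z` of `Z`. -/
  independent_on_Z : ∃ U : Set M, IsOpen U ∧ B.Z ⊆ closure (U ∩ B.Z) ∧
    ∀ p ∈ U ∩ B.Z, LinearIndependent ℝ (fun i ↦ (F i).d p)
  involution : ∀ i j : Fin s, i.val < r → ∀ p, Ω.bracket p ((F i).d p) ((F j).d p) = 0
  dim : r + s = 2 * n
  /-- The Hamiltonian vector fields of the commuting part are independent, as ordinary tangent
  vectors, at some point of `Z`. -/
  ham_independent : ∃ p ∈ B.Z, LinearIndependent ℝ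
    (fun i : Fin r ↦ anchor B p (Ω.ham p ((F (Fin.castLE r_le_s i)).d p)))

/-! ### The Poisson structure on the target space, and equivalence -/

/-- The points of `M` where all the functions `f₁, …, fₛ` are finite. -/
def finiteLocus {s : ℕ} (F : Fin s → BFunction B) : Set M :=
  {p | ∀ i, (F i).value p ≠ OnePoint.infty}

/-- The map `F` with values in `ℝˢ` (meaningful on the finite locus). -/
def realMap {s : ℕ} (F : Fin s → BFunction B) (p : M) : Fin s → ℝ := fun i ↦ (F i).realValue p

/-- The finite target space `V_F = F(M) ∩ ℝˢ`. -/
def target {s : ℕ} (F : Fin s → BFunction B) : Set (Fin s → ℝ) :=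
  {y | ∃ p, ∀ i, (F i).value p = ((y i : ℝ) : OnePoint ℝ)}

/-- A map on a subset `V` of `ℝˢ` is smooth if it is locally the restriction of smooth maps defined
on open subsets of `ℝˢ`. -/
def SmoothOnSubset {s : ℕ} {E : Type*} [NormedAddCommGroup E] [NormedSpace ℝ E]
    (V : Set (Fin s → ℝ)) (g : (Fin s → ℝ) → E) : Prop :=
  ∀ y ∈ V, ∃ (U : Set (Fin s → ℝ)) (G : (Fin s → ℝ) → E),
    IsOpen U ∧ y ∈ U ∧ ContDiffOn ℝ ∞ G U ∧ EqOn g G (U ∩ V)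

/-- The bracket `{g, h}_V` of two functions on `V_F`, defined by
`{g, h}_V ∘ F = {g ∘ F, h ∘ F}`: the number `b` is its value at `y`.  (Given as a graph, so that it
makes sense also when `{g ∘ F, h ∘ F}` takes different values on a fibre of `F`.) -/
def IsTargetBracket {s : ℕ} (Ω : BSymplecticForm B) (F : Fin s → BFunction B)
    (g h : (Fin s → ℝ) → ℝ) (y : Fin s → ℝ) (b : ℝ) : Prop :=
  ∃ p ∈ finiteLocus F, realMap F p = y ∧
    b = Ω.bracket p (dAt B (g ∘ realMap F) p) (dAt B (h ∘ realMap F) p)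

/-- `μ : V_F → V_{F'}` is a Poisson map: it is smooth, and
`{g ∘ μ, h ∘ μ}_{V_F} = {g, h}_{V_{F'}} ∘ μ` for all smooth functions `g, h` on `V_{F'}`. -/
def IsPoissonMap {s : ℕ} (Ω : BSymplecticForm B) (F F' : Fin s → BFunction B)
    (μ : (Fin s → ℝ) → (Fin s → ℝ)) : Prop :=
  MapsTo μ (target F) (target F') ∧ SmoothOnSubset (target F) μ ∧
    ∀ g h : (Fin s → ℝ) → ℝ, SmoothOnSubset (target F') g → SmoothOnSubset (target F') h →
      ∀ (y : Fin s → ℝ) (b : ℝ), IsTargetBracket Ω F (g ∘ μ) (h ∘ μ) y b →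
        IsTargetBracket Ω F' g h (μ y) b

/-- The systems `F` and `F'` are equivalent: there is a Poisson map `μ : V_F → V_{F'}` with
`F' = μ ∘ F` at the points where `F` is finite. -/
def Equivalent {s : ℕ} (Ω : BSymplecticForm B) (F F' : Fin s → BFunction B) : Prop :=
  ∃ μ : (Fin s → ℝ) → (Fin s → ℝ), IsPoissonMap Ω F F' μ ∧
    ∀ p ∈ finiteLocus F, ∀ i, (F' i).value p = ((μ (realMap F p) i : ℝ) : OnePoint ℝ)

end Systems

end BSymplectic

end

/-! Part (a) is a dimension count at points of `Z`, by contradiction. Let `e = (0, 1)` be the value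
of `t ∂/∂t` there. It spans the kernel of the anchor, `ι_e Ω = -α` on vectors tangent to `Z`, and
the differential of a smooth function vanishes on `e`.

Suppose all the functions are smooth. At the point `p` of `Z` where the vectors `X_{f_i}`, `i ≤ r`,
are independent in the tangent space, they remain independent when `e` is added. In terms of
covectors: `df_1, …, df_r, α, dt` are independent at `p` (`linearIndependent_diffAt_alpha_dt`).
These covectors vary continuously, so the same holds near `p`, in particular at some `q` in `Z`
where all `s` differentials are independent `b`-covectors. At `q` the `r + 1` vectors `X_{f_i}`, `e`
lie in the common kernel of the `df_j`, of dimension `2n - s = r`, so they are dependent.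
Contracting the relation with `Ω` gives one between the `df_i`, `α` and `dt`, a contradiction
(`not_linearIndependent_diffAt_alpha_dt`).

Part (b) is linear algebra on the functions. A commuting integral with logarithmic coefficient `c ≠
0` is moved to the first place and divided by `c`; multiples of it are subtracted from the others to
cancel their logarithms. The remaining `log|t₀| + g` equals `log|t₀ e^g|`, and `t₀ e^g` is again a
defining function. The change of functions is a linear map `μ` of `ℝˢ`, which gives the equivalence.
-/

namespace BSymplectic

/-! ### Openness of the independence of covector fields -/

section Openness

variable {m : ℕ} {M : Type*} [TopologicalSpace M] [ChartedSpace (EuclideanSpace ℝ (Fin m)) M]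
  [IsManifold (𝓡 m) ∞ M]

/-- A field of covectors, read in the trivialization of the tangent bundle at `p₀`. -/
noncomputable def covectorInCoordinates (p₀ : M)
    (φ : Π p : M, TangentSpace (𝓡 m) p →L[ℝ] ℝ) (p : M) : EuclideanSpace ℝ (Fin m) →L[ℝ] ℝ :=
  (φ p).comp
    ((trivializationAt (EuclideanSpace ℝ (Fin m)) (TangentSpace (𝓡 m)) p₀).symmL ℝ p)

theorem continuousAt_covectorInCoordinates_diffAt (g : C^∞⟮𝓡 m, M; ℝ⟯) (p : M) :
    ContinuousAt (covectorInCoordinates (m := m) p (diffAt g)) p := by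
  have h := ((g.contMDiff.contMDiffAt (x := p)).mfderiv_const (m := 0) (by simp)).continuousAt
  refine h.congr (Filter.Eventually.of_forall fun q ↦ ?_)
  ext v
  simp [inTangentCoordinates, ContinuousLinearMap.inCoordinates, covectorInCoordinates, diffAt]
  rfl

theorem continuousAt_covectorInCoordinates (φ : Π p : M, TangentSpace (𝓡 m) p →L[ℝ] ℝ)
    (hφ : ContMDiff (𝓡 m) ((𝓡 m).prod 𝓘(ℝ, EuclideanSpace ℝ (Fin m) →L[ℝ] ℝ)) ∞
      (fun p ↦ Bundle.TotalSpace.mk' (EuclideanSpace ℝ (Fin m) →L[ℝ] ℝ)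
        (E := fun p : M ↦ (TangentSpace (𝓡 m) p →L[ℝ] ℝ)) p (φ p))) (p : M) :
    ContinuousAt (covectorInCoordinates p φ) p := by
  have h := ((contMDiffAt_hom_bundle _).1 (hφ p)).2.continuousAt
  refine h.congr (Filter.Eventually.of_forall fun q ↦ ?_)
  ext v
  simp [ContinuousLinearMap.inCoordinates, covectorInCoordinates]

/-- Linear independence of finitely many continuous covector fields is an open condition. -/
theorem eventually_linearIndependent_of_continuousAt {ι : Type*} [Finite ι]
    (φ : ι → Π p : M, TangentSpace (𝓡 m) p →L[ℝ] ℝ) (p : M)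
    (hφ : ∀ i, ContinuousAt (covectorInCoordinates p (φ i)) p)
    (hp : LinearIndependent ℝ fun i ↦ φ i p) :
    ∀ᶠ q in nhds p, LinearIndependent ℝ fun i ↦ φ i q := by
  have hcont : ContinuousAt (fun q i ↦ covectorInCoordinates p (φ i) q) p :=
    continuousAt_pi.2 hφ
  have hcoord (q : M) : (fun i ↦ covectorInCoordinates p (φ i) q) =
      (ContinuousLinearMap.precomp ℝ ((trivializationAt (EuclideanSpace ℝ (Fin m))
        (TangentSpace (𝓡 m)) p).symmL ℝ q)).toLinearMap ∘ fun i ↦ φ i q := rfl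
  have hp' : LinearIndependent ℝ fun i ↦ covectorInCoordinates p (φ i) p := by
    rw [hcoord]
    -- The trivialization must be invertible only at `p` itself; at nearby points, independence of
    -- the images under a linear map already implies independence.
    refine hp.map' _ (LinearMap.ker_eq_bot.2 fun a b hab ↦ ?_)
    ext v
    have hmem := FiberBundle.mem_baseSet_trivializationAt' (F := EuclideanSpace ℝ (Fin m))
      (E := (TangentSpace (𝓡 m) : M → Type _)) p
    have := DFunLike.congr_fun hab ((trivializationAt (EuclideanSpace ℝ (Fin m))
        (TangentSpace (𝓡 m)) p).continuousLinearMapAt ℝ p v)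
    simpa only [ContinuousLinearMap.coe_coe, ContinuousLinearMap.precomp_apply,
      ContinuousLinearMap.comp_apply, Bundle.Trivialization.symmL_continuousLinearMapAt _ hmem]
      using this
  filter_upwards [hcont (isOpen_setOfPred_linearIndependent.mem_nhds hp')] with q hq
  rw [mem_preimage, mem_ofPred_eq, hcoord] at hq
  exact hq.of_comp _

end Openness

/-! ### Counting dimensions in a common kernel -/

/-- If `s` independent functionals vanish on `r + 1` vectors in dimension `r + s`, these vectors
are dependent. -/
theorem exists_dependence_of_dual_eq_zero {V : Type*} [AddCommGroup V] [Module ℝ V]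
    [FiniteDimensional ℝ V] {r s : ℕ} (hdim : r + s = Module.finrank ℝ V)
    (φ : Fin s → Module.Dual ℝ V) (hφ : LinearIndependent ℝ φ) (w : Fin r → V) (e : V)
    (hw : ∀ i j, φ j (w i) = 0) (he : ∀ j, φ j e = 0) :
    ∃ (c : Fin r → ℝ) (d : ℝ), ∑ i, c i • w i + d • e = 0 ∧ (d = 0 → c ≠ 0) := by
  set K := (Submodule.span ℝ (range φ)).dualCoannihilator with hK
  have hKdim : Module.finrank ℝ K = r := by
    have h := Subspace.finrank_add_finrank_dualCoannihilator_eq (Submodule.span ℝ (range φ))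
    rw [finrank_span_eq_card hφ, Fintype.card_fin, ← hK] at h
    omega
  have hmem (x : V) (hx : ∀ j, φ j x = 0) : x ∈ K := by
    rw [hK, Submodule.mem_dualCoannihilator]
    intro ψ hψ
    induction hψ using Submodule.span_induction with
    | mem ψ hψ => obtain ⟨j, rfl⟩ := hψ; exact hx j
    | zero => rfl
    | add ψ ψ' _ _ h₁ h₂ => rw [LinearMap.add_apply, h₁, h₂, add_zero]
    | smul a ψ _ h => rw [LinearMap.smul_apply, h, smul_zero]
  let v : Option (Fin r) → K :=
    fun o ↦ o.elim ⟨e, hmem e he⟩ fun i ↦ ⟨w i, hmem (w i) (hw i)⟩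
  have hv : ¬ LinearIndependent ℝ v := fun h ↦ by
    have := h.fintype_card_le_finrank
    simp [hKdim] at this
  rw [Fintype.not_linearIndependent_iff] at hv
  obtain ⟨c, hc, o, ho⟩ := hv
  refine ⟨fun i ↦ c (some i), c none, ?_, fun hd hc0 ↦ ho ?_⟩
  · have := congrArg Subtype.val hc
    rw [Fintype.sum_option] at this
    simpa [v, add_comm] using this
  · cases o with
    | none => exact hd
    | some i => exact congrFun hc0 i

/-! ### Linear algebra of the `b`-tangent space at a point of `Z` -/

section Pointwise

variable {m : ℕ} {M : Type*} [TopologicalSpace M] [ChartedSpace (EuclideanSpace ℝ (Fin m)) M]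
  {B : BManifold m M}

/-- The value `(0, 1)` of the field `t ∂/∂t` at a point of `Z`. -/
noncomputable def normalGenerator (B : BManifold m M) {p : M} (hp : p ∈ B.Z) : BTangent B p :=
  ⟨(0, 1), by
    change diffAt B.t p 0 = 1 * B.t p
    rw [map_zero, (B.isDefiningFunction.1 p).1 hp, mul_zero]⟩

@[simp]
theorem anchor_normalGenerator {p : M} (hp : p ∈ B.Z) : anchor B p (normalGenerator B hp) = 0 := rfl

@[simp]
theorem dlog_normalGenerator {p : M} (hp : p ∈ B.Z) : dlog B p (normalGenerator B hp) = 1 := rfl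

@[simp]
-- The anchor kills the generator. A `b`-function with logarithmic coefficient `c` would give the
-- value `c`, so this is where smoothness of all the integrals enters the contradiction.
theorem dAt_normalGenerator {p : M} (hp : p ∈ B.Z) (u : M → ℝ) :
    dAt B u p (normalGenerator B hp) = 0 := by
  simp [dAt]

theorem normalGenerator_ne_zero {p : M} (hp : p ∈ B.Z) : normalGenerator B hp ≠ 0 := fun h ↦
  one_ne_zero ((dlog_normalGenerator hp).symm.trans (h ▸ map_zero (dlog B p)))

theorem BFunction.IsSmooth.d_eq {f : BFunction B} (hf : f.IsSmooth) (p : M) :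
    f.d p = dAt B f.smoothPart p := by
  rw [BFunction.d, show f.coeff = 0 from hf, zero_smul, zero_add]

theorem diffAt_anchor_of_mem {p : M} (hp : p ∈ B.Z) (x : BTangent B p) :
    diffAt B.t p (anchor B p x) = 0 := by
  have h : diffAt B.t p (anchor B p x) = dlog B p x * B.t p := x.2
  rw [h, (B.isDefiningFunction.1 p).1 hp, mul_zero]

/-- A covector vanishing on the tangent space of `Z` is a multiple of `dt`. -/
theorem exists_eq_smul_diffAt_of_comp_anchor {p : M}
    (φ : TangentSpace (𝓡 m) p →L[ℝ] ℝ) (hφ : ∀ x : BTangent B p, φ (anchor B p x) = 0) :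
    ∃ z : ℝ, φ = z • diffAt B.t p := by
  have h : φ.toLinearMap ∈ Submodule.span ℝ (range fun _ : Unit ↦ (diffAt B.t p).toLinearMap) := by
    refine mem_span_of_iInf_ker_le_ker fun v hv ↦ ?_
    have hv' : diffAt B.t p v = 0 := by simpa using hv
    refine hφ ⟨(v, 0), ?_⟩
    change diffAt B.t p v = 0 * B.t p
    rw [hv', zero_mul]
  rw [range_const, Submodule.mem_span_singleton] at h
  obtain ⟨z, hz⟩ := h
  exact ⟨z, ContinuousLinearMap.coe_injective hz.symm⟩

/-- On `Z` the equation `dt(v) = a t` becomes `dt(v) = 0`, one nontrivial condition on a space of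
dimension `m + 1`. -/
theorem finrank_BTangent {p : M} (hp : p ∈ B.Z) : Module.finrank ℝ (BTangent B p) = m := by
  have hV : Module.finrank ℝ (TangentSpace (𝓡 m) p) = m := finrank_euclideanSpace_fin
  have hker : Module.finrank ℝ (LinearMap.ker
      ((diffAt B.t p).toLinearMap.comp (LinearMap.fst ℝ (TangentSpace (𝓡 m) p) ℝ))) = m := by
    have hne : (diffAt B.t p).toLinearMap.comp (LinearMap.fst ℝ (TangentSpace (𝓡 m) p) ℝ) ≠ 0 := by
      intro h0
      refine B.isDefiningFunction.2 p hp ?_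
      ext v
      exact DFunLike.congr_fun h0 (v, 0)
    have h := Module.Dual.finrank_ker_add_one_of_ne_zero hne
    rw [Module.finrank_prod, hV, Module.finrank_self] at h
    omega
  have hB : BTangent B p = LinearMap.ker
      ((diffAt B.t p).toLinearMap.comp (LinearMap.fst ℝ (TangentSpace (𝓡 m) p) ℝ)) := by
    ext x
    change diffAt B.t p x.1 = x.2 * B.t p ↔ diffAt B.t p x.1 = 0
    rw [(B.isDefiningFunction.1 p).1 hp, mul_zero]
  rw [hB, hker]

variable [IsManifold (𝓡 m) ∞ M]

/-- This translates relations between Hamiltonian vectors and the generator into relations between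
differentials and `α`. -/
theorem BTwoForm.at_normalGenerator (Ω : BTwoForm B) {p : M} (hp : p ∈ B.Z) (x : BTangent B p) :
    Ω.at p (normalGenerator B hp) x = -Ω.α p (anchor B p x) := by
  simp [BTwoForm.at]

theorem BSymplecticForm.at_ham (Ω : BSymplecticForm B) (p : M) (ξ : Module.Dual ℝ (BTangent B p))
    (x : BTangent B p) : Ω.at p (Ω.ham p ξ) x = -ξ x := by
  have h := LinearEquiv.apply_symm_apply ((Ω.at p).toDual (Ω.nondegenerate p)) (-ξ)
  exact DFunLike.congr_fun h x

theorem BSymplecticForm.eq_zero_of_at (Ω : BSymplecticForm B) {p : M} {x : BTangent B p}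
    (hx : ∀ y, Ω.at p x y = 0) : x = 0 :=
  (Ω.nondegenerate p).1 x hx

theorem BTwoForm.at_self (Ω : BTwoForm B) (p : M) (x : BTangent B p) : Ω.at p x x = 0 := by
  simp [BTwoForm.at, Ω.β_alt]

theorem BTwoForm.at_swap (Ω : BTwoForm B) (p : M) (x y : BTangent B p) :
    Ω.at p x y = -Ω.at p y x := by
  have h := Ω.at_self p (x + y)
  simp only [map_add, LinearMap.add_apply, Ω.at_self] at h
  linarith

/-- Involution thereby says that the Hamiltonian vectors of the commuting part lie in the common
kernel of all the differentials. -/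
theorem BSymplecticForm.bracket_eq (Ω : BSymplecticForm B) (p : M)
    (ξ η : Module.Dual ℝ (BTangent B p)) : Ω.bracket p ξ η = η (Ω.ham p ξ) := by
  rw [bracket, BTwoForm.at_swap, Ω.at_ham, neg_neg]

/-- The Hamiltonian vectors as a linear function of the `b`-covectors. -/
noncomputable def BSymplecticForm.hamLinear (Ω : BSymplecticForm B) (p : M) :
    Module.Dual ℝ (BTangent B p) →ₗ[ℝ] BTangent B p :=
  -((Ω.at p).toDual (Ω.nondegenerate p)).symm.toLinearMap

theorem BSymplecticForm.hamLinear_apply (Ω : BSymplecticForm B) (p : M)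
    (ξ : Module.Dual ℝ (BTangent B p)) : Ω.hamLinear p ξ = Ω.ham p ξ := by
  simp [hamLinear, ham]

/-- At a point of `Z`, if the Hamiltonian vectors of smooth functions are independent as ordinary
tangent vectors, then the differentials, together with `α` and `dt`, are independent. -/
theorem linearIndependent_diffAt_alpha_dt (Ω : BSymplecticForm B) {ι : Type*} [Fintype ι]
    {p : M} (hp : p ∈ B.Z) (g : ι → C^∞⟮𝓡 m, M; ℝ⟯)
    (h : LinearIndependent ℝ fun i ↦ anchor B p (Ω.ham p (dAt B (g i) p))) :
    LinearIndependent ℝ (Sum.elim (fun i ↦ diffAt (g i) p) ![Ω.α p, diffAt B.t p]) := by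
  rw [Fintype.linearIndependent_iff] at h ⊢
  intro c hc
  simp only [Fintype.sum_sum_type, Sum.elim_inl, Sum.elim_inr, Fin.sum_univ_two,
    Matrix.cons_val_zero, Matrix.cons_val_one] at hc
  -- Evaluated on vectors tangent to `Z`, the given relation loses its `dt` term; the rest is, up to
  -- sign, the contraction of this vector with `Ω`.
  have hvec : ∑ i, c (.inl i) • Ω.ham p (dAt B (g i) p) + c (.inr 0) • normalGenerator B hp = 0 := by
    refine Ω.eq_zero_of_at fun y ↦ ?_
    have hy := DFunLike.congr_fun hc (anchor B p y)
    simp only [add_apply, sum_apply,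
      smul_apply, diffAt_anchor_of_mem hp, smul_eq_mul, mul_zero, add_zero,
      zero_apply] at hy
    simp only [map_add, map_sum, map_smul, LinearMap.add_apply, LinearMap.sum_apply,
      LinearMap.smul_apply, Ω.at_ham, Ω.at_normalGenerator, smul_eq_mul, mul_neg,
      Finset.sum_neg_distrib, dAt, LinearMap.comp_apply, ContinuousLinearMap.coe_coe]
    linarith
  have h1 : ∀ i, c (.inl i) = 0 := by
    refine h _ ?_
    have := congrArg (anchor B p) hvec
    simpa using this
  have h2 : c (.inr 0) = 0 := by
    simpa [h1, normalGenerator_ne_zero] using hvec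
  have h3 : c (.inr 1) = 0 := by
    simpa [h1, h2, B.isDefiningFunction.2 p hp] using hc
  rintro (i | i)
  · exact h1 i
  · fin_cases i
    exacts [h2, h3]

/-- At a point of `Z`, a full set of independent smooth functions whose first `r` members commute
with all of them cannot have the differentials of the commuting part independent of `α` and `dt`:
the vector `t ∂/∂t` is a combination of their Hamiltonian vectors. -/
theorem not_linearIndependent_diffAt_alpha_dt (Ω : BSymplecticForm B) {r s : ℕ} (hrs : r ≤ s)
    (hdim : r + s = m) {q : M} (hq : q ∈ B.Z) (g : Fin s → C^∞⟮𝓡 m, M; ℝ⟯)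
    (hind : LinearIndependent ℝ fun i ↦ dAt B (g i) q)
    (hinv : ∀ i j : Fin s, i.val < r → Ω.bracket q (dAt B (g i) q) (dAt B (g j) q) = 0) :
    ¬ LinearIndependent ℝ (Sum.elim (fun i : Fin r ↦ diffAt (g (Fin.castLE hrs i)) q)
      ![Ω.α q, diffAt B.t q]) := by
  intro hli
  obtain ⟨c, d, hc, hcd⟩ := exists_dependence_of_dual_eq_zero
    (hdim.trans (finrank_BTangent hq).symm) _ hind
    (fun i : Fin r ↦ Ω.ham q (dAt B (g (Fin.castLE hrs i)) q)) (normalGenerator B hq)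
    (fun i j ↦ by rw [← Ω.bracket_eq]; exact hinv _ j i.2)
    (fun j ↦ dAt_normalGenerator hq _)
  -- Contracting the dependence with `Ω` yields a covector that vanishes on the tangent space of
  -- `Z`.
  obtain ⟨z, hz⟩ := exists_eq_smul_diffAt_of_comp_anchor
    (∑ i : Fin r, c i • diffAt (g (Fin.castLE hrs i)) q + d • Ω.α q) fun x ↦ by
      have h := congrArg (fun y ↦ Ω.at q y x) hc
      simp only [map_add, map_sum, map_smul, LinearMap.add_apply, LinearMap.sum_apply,
        LinearMap.smul_apply, Ω.at_ham, Ω.at_normalGenerator, smul_eq_mul, mul_neg,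
        Finset.sum_neg_distrib, dAt, LinearMap.comp_apply, ContinuousLinearMap.coe_coe,
        map_zero, LinearMap.zero_apply] at h
      simp only [add_apply, sum_apply,
        smul_apply, smul_eq_mul]
      linarith
  rw [Fintype.linearIndependent_iff] at hli
  have hzero := hli (Sum.elim c ![d, -z]) (by
    simp only [Fintype.sum_sum_type, Sum.elim_inl, Sum.elim_inr, Fin.sum_univ_two,
      Matrix.cons_val_zero, Matrix.cons_val_one]
    rw [← add_assoc, hz, neg_smul, add_neg_cancel])
  exact hcd (hzero (.inr 0)) (funext fun i ↦ hzero (.inl i))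

end Pointwise

/-! ### Linear changes of `b`-functions and of the defining function -/

section ChangeOfFunctions

/-- The change of vectors is the identity plus a matrix supported in the column `i₀`; its
determinant is `1 + b i₀`. -/
theorem linearIndependent_add_smul {V ι : Type*} [AddCommGroup V] [Module ℝ V] [Fintype ι]
    {v : ι → V} (hv : LinearIndependent ℝ v) (b : ι → ℝ) (i₀ : ι) (hb : 1 + b i₀ ≠ 0) :
    LinearIndependent ℝ fun i ↦ v i + b i • v i₀ := by
  classical
  rw [Fintype.linearIndependent_iff] at hv ⊢
  intro x hx
  have key := hv (fun i ↦ x i + if i = i₀ then ∑ j, x j * b j else 0) (by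
    simp only [add_smul, ite_smul, zero_smul, Finset.sum_add_distrib, Finset.sum_ite_eq',
      Finset.mem_univ, if_true, Finset.sum_smul]
    simpa only [smul_add, Finset.sum_add_distrib, smul_smul] using hx)
  have hne (i : ι) (hi : i ≠ i₀) : x i = 0 := by simpa [hi] using key i
  have h0 : x i₀ = 0 := by
    have h := key i₀
    rw [if_pos rfl, Finset.sum_eq_single i₀ (fun j _ hj ↦ by rw [hne j hj, zero_mul])
      (by simp)] at h
    exact (mul_eq_zero.1 (show x i₀ * (1 + b i₀) = 0 by linarith)).resolve_right hb
  intro i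
  by_cases hi : i = i₀
  exacts [hi ▸ h0, hne i hi]

variable {m : ℕ} {M : Type*} [TopologicalSpace M] [ChartedSpace (EuclideanSpace ℝ (Fin m)) M]
  {B : BManifold m M}

theorem mdifferentiableAt_smooth (g : C^∞⟮𝓡 m, M; ℝ⟯) (p : M) :
    MDifferentiableAt (𝓡 m) 𝓘(ℝ, ℝ) g p :=
  (g.contMDiff p).mdifferentiableAt (by simp)

/-- The `b`-function `f + b g`. -/
noncomputable def BFunction.addSMul (f : BFunction B) (b : ℝ) (g : BFunction B) : BFunction B where
  coeff := f.coeff + b * g.coeff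
  smoothPart := f.smoothPart + b • g.smoothPart

theorem BFunction.realValue_addSMul (f g : BFunction B) (b : ℝ) (p : M) :
    (f.addSMul b g).realValue p = f.realValue p + b * g.realValue p := by
  simp only [realValue, addSMul, ContMDiffMap.coe_add, ContMDiffMap.coe_smul, Pi.add_apply,
    Pi.smul_apply, smul_eq_mul]
  ring

theorem BFunction.d_addSMul (f g : BFunction B) (b : ℝ) (p : M) :
    (f.addSMul b g).d p = f.d p + b • g.d p := by
  have h : diffAt (m := m) (f.smoothPart + b • g.smoothPart : C^∞⟮𝓡 m, M; ℝ⟯) p =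
      diffAt f.smoothPart p + b • diffAt g.smoothPart p :=
    ((mdifferentiableAt_smooth f.smoothPart p).hasMFDerivAt.add
      ((mdifferentiableAt_smooth g.smoothPart p).hasMFDerivAt.const_smul b)).mfderiv
  ext x
  simp only [d, addSMul, dAt, h, LinearMap.add_apply, LinearMap.smul_apply, LinearMap.comp_apply,
    ContinuousLinearMap.coe_coe, add_apply, smul_apply, smul_eq_mul]
  ring

theorem BFunction.value_eq_coe {f : BFunction B} {p : M} (h : f.value p ≠ OnePoint.infty) :
    f.value p = ((f.realValue p : ℝ) : OnePoint ℝ) := by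
  unfold value at h ⊢
  split_ifs at h ⊢ with h'
  · exact absurd rfl h
  · rfl

theorem BFunction.value_ne_infty_iff {f : BFunction B} {p : M} :
    f.value p ≠ OnePoint.infty ↔ (p ∈ B.Z → f.coeff = 0) := by
  unfold value
  split_ifs with h
  · simp [h]
  · simp only [ne_eq, OnePoint.coe_ne_infty, not_false_eq_true, true_iff]
    tauto

theorem BFunction.value_addSMul_ne_infty {f g : BFunction B} {p : M}
    (hf : f.value p ≠ OnePoint.infty) (hg : g.value p ≠ OnePoint.infty) (b : ℝ) :
    (f.addSMul b g).value p ≠ OnePoint.infty := by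
  rw [value_ne_infty_iff] at *
  intro hp
  simp [addSMul, hf hp, hg hp]

/-- The function `t e^g`. -/
noncomputable def mulExp (t g : C^∞⟮𝓡 m, M; ℝ⟯) : C^∞⟮𝓡 m, M; ℝ⟯ :=
  t * ⟨fun p ↦ Real.exp (g p), Real.contDiff_exp.contMDiff.comp g.contMDiff⟩

theorem mulExp_apply (t g : C^∞⟮𝓡 m, M; ℝ⟯) (p : M) : mulExp t g p = t p * Real.exp (g p) := rfl

theorem mulExp_eq_zero {t g : C^∞⟮𝓡 m, M; ℝ⟯} {p : M} : mulExp t g p = 0 ↔ t p = 0 := by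
  simp [mulExp_apply, Real.exp_ne_zero]

theorem IsDefiningFunction.mulExp {Z : Set M} {t : C^∞⟮𝓡 m, M; ℝ⟯} (ht : IsDefiningFunction Z t)
    (g : C^∞⟮𝓡 m, M; ℝ⟯) : IsDefiningFunction Z (mulExp t g) := by
  refine ⟨fun p ↦ by rw [mulExp_eq_zero, ht.1], fun p hp ↦ ?_⟩
  let e : C^∞⟮𝓡 m, M; ℝ⟯ :=
    ⟨fun p ↦ Real.exp (g p), Real.contDiff_exp.contMDiff.comp g.contMDiff⟩
  have h : diffAt (m := m) (BSymplectic.mulExp t g) p = t p • diffAt e p + e p • diffAt t p :=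
    ((mdifferentiableAt_smooth t p).hasMFDerivAt.mul
      (mdifferentiableAt_smooth e p).hasMFDerivAt).mfderiv
  rw [h, (ht.1 p).1 hp, zero_smul, zero_add]
  exact smul_ne_zero (Real.exp_ne_zero _) (ht.2 p hp)

/-- Off `Z` this is `log|t| + g = log|t e^g|`; on `Z` both sides are infinite. -/
theorem BFunction.value_eq_logAbs_mulExp {f : BFunction B} (hf : f.coeff = 1) (p : M) :
    f.value p = logAbs (mulExp B.t f.smoothPart) p := by
  by_cases hp : p ∈ B.Z
  · have h0 : B.t p = 0 := (B.isDefiningFunction.1 p).1 hp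
    simp [value, logAbs, mulExp_eq_zero, hf, hp, h0]
  · have h0 : B.t p ≠ 0 := fun h ↦ hp ((B.isDefiningFunction.1 p).2 h)
    rw [value, if_neg (fun h ↦ hp h.2), logAbs, if_neg (by rwa [mulExp_eq_zero])]
    rw [realValue, hf, mulExp_apply, abs_mul, Real.log_mul (abs_ne_zero.2 h0)
      (abs_ne_zero.2 (Real.exp_ne_zero _)), Real.abs_exp, Real.log_exp, one_mul]

end ChangeOfFunctions

/-! ### Transformed systems, and the logarithm in the commuting part -/

section Systems

variable {n : ℕ} {M : Type*} [TopologicalSpace M]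
  [ChartedSpace (EuclideanSpace ℝ (Fin (2 * n))) M]
  {B : BManifold (2 * n) M}

/-- The system with members `f_{σ i} + b_i f_{σ i₀}`. -/
noncomputable def changeSystem {s : ℕ} (σ : Equiv.Perm (Fin s)) (b : Fin s → ℝ) (i₀ : Fin s)
    (F : Fin s → BFunction B) (i : Fin s) : BFunction B :=
  (F (σ i)).addSMul (b i) (F (σ i₀))

variable [IsManifold (𝓡 (2 * n)) ∞ M]

/-- A linear change of the functions gives an equivalent system. -/
theorem equivalent_changeSystem (Ω : BSymplecticForm B) {s : ℕ} (σ : Equiv.Perm (Fin s))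
    (b : Fin s → ℝ) (i₀ : Fin s) (F : Fin s → BFunction B) :
    Equivalent Ω F (changeSystem σ b i₀ F) := by
  let μ : (Fin s → ℝ) → (Fin s → ℝ) := fun y i ↦ y (σ i) + b i * y (σ i₀)
  have hμ (p : M) : realMap (changeSystem σ b i₀ F) p = μ (realMap F p) :=
    funext fun i ↦ BFunction.realValue_addSMul _ _ _ _
  have hfin {p : M} (hp : p ∈ finiteLocus F) : p ∈ finiteLocus (changeSystem σ b i₀ F) :=
    fun i ↦ BFunction.value_addSMul_ne_infty (hp _) (hp _) _
  have hval {p : M} (hp : p ∈ finiteLocus F) (i : Fin s) :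
      (changeSystem σ b i₀ F i).value p = ((μ (realMap F p) i : ℝ) : OnePoint ℝ) := by
    rw [BFunction.value_eq_coe (hfin hp i), ← hμ]
    rfl
  refine ⟨μ, ⟨?_, ?_, ?_⟩, fun p hp ↦ hval hp⟩
  · rintro y ⟨p, hp⟩
    have hpF : p ∈ finiteLocus F := fun i ↦ by rw [hp i]; exact OnePoint.coe_ne_infty _
    have hy : realMap F p = y := funext fun i ↦
      OnePoint.coe_injective ((BFunction.value_eq_coe (hpF i)).symm.trans (hp i))
    exact ⟨p, fun i ↦ hy ▸ hval hpF i⟩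
  · exact fun y _ ↦ ⟨univ, μ, isOpen_univ, mem_univ y, by fun_prop, fun _ _ ↦ rfl⟩
  -- The same point `p` witnesses both brackets, since composing `g ∘ μ` with the old map is
  -- composing `g` with the new one.
  · rintro g h - - y c ⟨p, hp, rfl, hc⟩
    have hcomp : realMap (changeSystem σ b i₀ F) = μ ∘ realMap F := funext hμ
    exact ⟨p, hfin hp, hμ p, by rw [hc, hcomp]; rfl⟩

/-- A linear change of the functions which preserves the commuting part and makes the other
functions smooth gives an integrable system. -/
theorem IsNCBIntegrable.changeSystem {Ω : BSymplecticForm B} {r s : ℕ} {F : Fin s → BFunction B}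
    (hF : IsNCBIntegrable Ω r s F) (τ : Equiv.Perm (Fin r)) (σ : Equiv.Perm (Fin s))
    (b : Fin s → ℝ) (i₀ : Fin r) (hb : 1 + b (Fin.castLE hF.r_le_s i₀) ≠ 0)
    (hστ : ∀ i, σ (Fin.castLE hF.r_le_s i) = Fin.castLE hF.r_le_s (τ i))
    (hsmooth : ∀ i : Fin s, r ≤ i.val →
      (BSymplectic.changeSystem σ b (Fin.castLE hF.r_le_s i₀) F i).IsSmooth) :
    IsNCBIntegrable Ω r s (BSymplectic.changeSystem σ b (Fin.castLE hF.r_le_s i₀) F) := by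
  have hd (p : M) : (fun i ↦ (BSymplectic.changeSystem σ b (Fin.castLE hF.r_le_s i₀) F i).d p) =
      fun i ↦ (F (σ i)).d p + b i • (F (σ (Fin.castLE hF.r_le_s i₀))).d p :=
    funext fun i ↦ BFunction.d_addSMul _ _ _ _
  have hind {p : M} (h : LinearIndependent ℝ fun i ↦ (F i).d p) : LinearIndependent ℝ
      fun i ↦ (BSymplectic.changeSystem σ b (Fin.castLE hF.r_le_s i₀) F i).d p := by
    rw [hd]
    exact linearIndependent_add_smul (h.comp σ σ.injective) b _ hb
  refine ⟨hF.r_le_s, hsmooth, ?_, ?_, ?_, hF.dim, ?_⟩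
  · obtain ⟨U, hU, hU', h⟩ := hF.independent
    exact ⟨U, hU, hU', fun p hp ↦ hind (h p hp)⟩
  · obtain ⟨U, hU, hU', h⟩ := hF.independent_on_Z
    exact ⟨U, hU, hU', fun p hp ↦ hind (h p hp)⟩
  · intro i j hi p
    have hσ (k : Fin s) (hk : k.val < r) : (σ k).val < r := by
      have := hστ ⟨k, hk⟩
      rw [show Fin.castLE hF.r_le_s ⟨k, hk⟩ = k from rfl] at this
      rw [this]
      exact (τ _).2
    have h₁ (k l : Fin s) (hk : k.val < r) : (F l).d p (Ω.hamLinear p ((F k).d p)) = 0 := by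
      rw [Ω.hamLinear_apply, ← Ω.bracket_eq]
      exact hF.involution k l hk p
    have h₀ := hσ (Fin.castLE hF.r_le_s i₀) i₀.2
    -- The bracket expands into four brackets of old functions, each with first entry in the
    -- commuting part.
    rw [Ω.bracket_eq, ← Ω.hamLinear_apply, congrFun (hd p) i, congrFun (hd p) j]
    simp only [map_add, map_smul, LinearMap.add_apply, LinearMap.smul_apply, h₁ _ _ (hσ i hi),
      h₁ _ _ h₀, smul_zero, add_zero]
  · obtain ⟨p, hp, h⟩ := hF.ham_independent
    refine ⟨p, hp, ?_⟩
    have h' := linearIndependent_add_smul (h.comp τ τ.injective)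
      (fun i ↦ b (Fin.castLE hF.r_le_s i)) i₀ hb
    convert h' using 2 with i
    rw [congrFun (hd p)]
    simp only [← Ω.hamLinear_apply, map_add, map_smul, Function.comp_apply, hστ]

/-- The commuting part of a non-commutative `b`-integrable system is not smooth. -/
theorem IsNCBIntegrable.exists_not_isSmooth {Ω : BSymplecticForm B} {r s : ℕ}
    {F : Fin s → BFunction B} (hF : IsNCBIntegrable Ω r s F) :
    ∃ i : Fin r, ¬ (F (Fin.castLE hF.r_le_s i)).IsSmooth := by
  by_contra! hcomm
  have hsm (i : Fin s) : (F i).IsSmooth := by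
    by_cases hi : i.val < r
    exacts [hcomm ⟨i, hi⟩, hF.smooth_of_le i (not_lt.1 hi)]
  obtain ⟨p, hp, hham⟩ := hF.ham_independent
  obtain ⟨U, -, hUZ, hU⟩ := hF.independent_on_Z
  simp only [(hsm _).d_eq] at hham hU
  -- Passing to covectors lets continuity be read off from the smooth data, without inverting `Ω`
  -- over a neighbourhood.
  have hp' := linearIndependent_diffAt_alpha_dt Ω hp
    (fun i ↦ (F (Fin.castLE hF.r_le_s i)).smoothPart) hham
  let φ : Fin r ⊕ Fin 2 → Π q : M, TangentSpace (𝓡 (2 * n)) q →L[ℝ] ℝ :=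
    Sum.elim (fun i ↦ diffAt (F (Fin.castLE hF.r_le_s i)).smoothPart) ![Ω.α, diffAt B.t]
  have hφ (q : M) : (fun i ↦ φ i q) = Sum.elim
      (fun i ↦ diffAt (F (Fin.castLE hF.r_le_s i)).smoothPart q) ![Ω.α q, diffAt B.t q] := by
    funext i
    rcases i with i | i
    · rfl
    · fin_cases i <;> rfl
  have hcont (i) : ContinuousAt (covectorInCoordinates p (φ i)) p := by
    rcases i with i | i
    · exact continuousAt_covectorInCoordinates_diffAt _ p
    · fin_cases i
      · exact continuousAt_covectorInCoordinates Ω.α Ω.α_smooth p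
      · exact continuousAt_covectorInCoordinates_diffAt B.t p
  have hev := eventually_linearIndependent_of_continuousAt φ p hcont (by rw [hφ]; exact hp')
  obtain ⟨q, hq, hqU⟩ := mem_closure_iff_nhds.1 (hUZ hp) _ hev
  have hq' : LinearIndependent ℝ fun i ↦ φ i q := hq
  rw [hφ] at hq'
  refine not_linearIndependent_diffAt_alpha_dt Ω hF.r_le_s hF.dim hqU.2
    (fun i ↦ (F i).smoothPart) (hU q hqU) (fun i j hi ↦ ?_) hq'
  have h := hF.involution i j hi q
  rwa [(hsm i).d_eq, (hsm j).d_eq] at h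

end Systems

end BSymplectic

/-! ### Normalizing the system -/

theorem mainTheorem3 {n : ℕ} {M : Type*} [TopologicalSpace M] [T2Space M]
    [SecondCountableTopology M] [ChartedSpace (EuclideanSpace ℝ (Fin (2 * n))) M]
    [IsManifold (𝓡 (2 * n)) ∞ M]
    (B : BSymplectic.BManifold (2 * n) M) (Ω : BSymplectic.BSymplecticForm B)
    (r s : ℕ) (F : Fin s → BSymplectic.BFunction B)
    (hF : BSymplectic.IsNCBIntegrable Ω r s F) :
    (∃ i : Fin s, i.val < r ∧ ¬ (F i).IsSmooth) ∧
    ∃ (t : C^∞⟮𝓡 (2 * n), M; ℝ⟯) (F' : Fin s → BSymplectic.BFunction B) (i₀ : Fin s),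
      BSymplectic.IsDefiningFunction B.Z t ∧
      BSymplectic.IsNCBIntegrable Ω r s F' ∧
      BSymplectic.Equivalent Ω F F' ∧
      i₀.val = 0 ∧
      (∀ p, (F' i₀).value p = BSymplectic.logAbs t p) ∧
      (∀ i : Fin s, i ≠ i₀ → (F' i).IsSmooth) := by
  obtain ⟨k, hk⟩ := hF.exists_not_isSmooth
  refine ⟨⟨_, k.2, hk⟩, ?_⟩
  let i₀ : Fin r := ⟨0, k.pos⟩
  let ι : Fin r → Fin s := Fin.castLE hF.r_le_s
  let c : ℝ := (F (ι k)).coeff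
  have hc : c ≠ 0 := hk
  let σ : Equiv.Perm (Fin s) := Equiv.swap (ι i₀) (ι k)
  -- In place `i₀` the multiplier turns `f_k` into `f_k + (c⁻¹ - 1) f_k = f_k / c`; elsewhere it
  -- cancels the logarithmic coefficient.
  let b : Fin s → ℝ := fun i ↦ if i = ι i₀ then c⁻¹ - 1 else -((F (σ i)).coeff / c)
  have hσ₀ : σ (ι i₀) = ι k := Equiv.swap_apply_left _ _
  have hcoeff (i : Fin s) : (BSymplectic.changeSystem σ b (ι i₀) F i).coeff =
      (F (σ i)).coeff + b i * c := by
    simp only [BSymplectic.changeSystem, BSymplectic.BFunction.addSMul, hσ₀, c]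
  have hb₀ : b (ι i₀) = c⁻¹ - 1 := if_pos rfl
  have hlog : (BSymplectic.changeSystem σ b (ι i₀) F (ι i₀)).coeff = 1 := by
    rw [hcoeff, hσ₀, hb₀]
    change c + (c⁻¹ - 1) * c = 1
    field_simp
    ring
  have hsm (i : Fin s) (hi : i ≠ ι i₀) :
      (BSymplectic.changeSystem σ b (ι i₀) F i).IsSmooth := by
    have hbi : b i = -((F (σ i)).coeff / c) := if_neg hi
    change BSymplectic.BFunction.coeff _ = 0
    rw [hcoeff, hbi]
    field_simp
    ring
  refine ⟨BSymplectic.mulExp B.t _, BSymplectic.changeSystem σ b (ι i₀) F, ι i₀,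
    B.isDefiningFunction.mulExp _, ?_, BSymplectic.equivalent_changeSystem Ω σ b (ι i₀) F, rfl,
    BSymplectic.BFunction.value_eq_logAbs_mulExp hlog, hsm⟩
  refine hF.changeSystem (Equiv.swap i₀ k) σ b i₀ ?_ ?_ fun i hi ↦ hsm i ?_
  · change 1 + b (ι i₀) ≠ 0
    rw [hb₀, add_sub_cancel]
    exact inv_ne_zero hc
  · exact fun i ↦ (Fin.castLE_injective hF.r_le_s).swap_apply i₀ k i
  · rintro rfl
    exact absurd k.pos (not_lt.2 hi)
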